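/- Let $\nu>0$. Let $L^{2,\nu}(\mathbb R,\mathbb C)$ be the Hilbert space of (classes of) functions $f:\mathbb R\to\mathbb C$ that are square integrable with respect to $e^{-\nu x^2}dx$, and let $\mathcal F^{2,\nu}(\mathbb C^2)$ be the Bargmann-Fock space of all holomorphic functions on $\mathbb C^2$ that are square integrable with respect to $e^{-\nu(|z|^2+|w|^2)}d\lambda(z,w)$, where $\lambda$ is Lebesgue measure, with the $L^2$ inner product and norm for this measure. For $f\in L^{2,\nu}(\mathbb R,\mathbb C)$ and $\zeta,z,w\in\mathbb C$ put $$\mathcal B^{1,\nu}f(\zeta)=\left(\frac{\nu}{\pi}\right)^{3/4}\int_{\mathbb R}f(x)\,e^{-\nu\left(x-\frac{\zeta}{\sqrt2}\right)^2}dx,\qquad \mathcal G^{\nu}f(z,w)=\left(\frac{\nu}{\pi}\right)^{1/2}\mathcal B^{1,\nu}f\left(\frac{z+iw}{\sqrt2}\right).$$ Define $$\mathcal A^{2,\nu}(\mathbb C^2)=\left\{F\in\mathcal F^{2,\nu}(\mathbb C^2):\ \left(\frac{\partial}{\partial z}+i\frac{\partial}{\partial w}\right)F=0\ \text{on}\ \mathbb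 C^2\right\}.$$ Then: (i) $\mathcal A^{2,\nu}(\mathbb C^2)$ is a closed subspace of $\mathcal F^{2,\nu}(\mathbb C^2)$. (ii) $\mathcal A^{2,\nu}(\mathbb C^2)$, with the inner product of $\mathcal F^{2,\nu}(\mathbb C^2)$, is a Hilbert space, and the functions $e_m^\nu(z,w)=(z+iw)^m$, $m=0,1,2,\dots$, form an orthogonal basis of it: they are nonzero elements of it, pairwise orthogonal, and their linear span is dense in it. (iii) $\mathcal A^{2,\nu}(\mathbb C^2)=\mathcal G^\nu\left(L^{2,\nu}(\mathbb R,\mathbb C)\right)$ as sets of functions on $\mathbb C^2$. -/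

import Mathlib

open MeasureTheory

noncomputable section

namespace BargmannFock

/-- The measure `e^{-ν x²} dx` on the real line. -/
def gaussR (ν : ℝ) : Measure ℝ :=
  volume.withDensity fun x => ENNReal.ofReal (Real.exp (-ν * x ^ 2))

/-- The measure `e^{-ν (|z|² + |w|²)} dλ(z, w)` on `ℂ²`, with `λ` the Lebesgue measure. -/
def gaussC2 (ν : ℝ) : Measure (ℂ × ℂ) :=
  volume.withDensity fun p => ENNReal.ofReal (Real.exp (-ν * (‖p.1‖ ^ 2 + ‖p.2‖ ^ 2)))

/-- The Hilbert space `L^{2,ν}(ℝ, ℂ)`. -/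
abbrev L2R (ν : ℝ) : Type := Lp ℂ 2 (gaussR ν)

/-- The one-dimensional Segal-Bargmann transform
`B f (ζ) = (ν/π)^{3/4} ∫ f(x) e^{-ν (x - ζ/√2)²} dx`. -/
def segalBargmann (ν : ℝ) (f : ℝ → ℂ) (ζ : ℂ) : ℂ :=
  (((ν / Real.pi) ^ (3 / 4 : ℝ) : ℝ) : ℂ) *
    ∫ x : ℝ, f x * Complex.exp (-(ν : ℂ) * ((x : ℂ) - ζ / (Real.sqrt 2 : ℂ)) ^ 2)

/-- The transform `G f (z, w) = (ν/π)^{1/2} (B f)((z + i w)/√2)`. -/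
def transformG (ν : ℝ) (f : ℝ → ℂ) (p : ℂ × ℂ) : ℂ :=
  (((ν / Real.pi) ^ (1 / 2 : ℝ) : ℝ) : ℂ) *
    segalBargmann ν f ((p.1 + Complex.I * p.2) / (Real.sqrt 2 : ℂ))

/-- The holomorphic functions on `ℂ²` that are square integrable for `gaussC2 ν`,
as a subspace of all functions. -/
def fockSubmodule (ν : ℝ) : Submodule ℂ (ℂ × ℂ → ℂ) where
  carrier := {F | Differentiable ℂ F ∧ MemLp F 2 (gaussC2 ν)}
  add_mem' := fun hF hG => ⟨hF.1.add hG.1, hF.2.add hG.2⟩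
  zero_mem' := ⟨differentiable_const 0, MemLp.zero⟩
  smul_mem' := fun c _ hF => ⟨hF.1.const_smul c, hF.2.const_smul c⟩

/-- The two-dimensional Bargmann-Fock space. It is a type of its own, so that its topology is the
one of the `L²` norm below and not the one of pointwise convergence. -/
def Fock (ν : ℝ) : Type := ↥(fockSubmodule ν)

namespace Fock

instance instAddCommGroup (ν : ℝ) : AddCommGroup (Fock ν) :=
  inferInstanceAs (AddCommGroup ↥(fockSubmodule ν))

instance instModule (ν : ℝ) : Module ℂ (Fock ν) :=
  inferInstanceAs (Module ℂ ↥(fockSubmodule ν))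

/-- The function underlying an element of the Bargmann-Fock space. -/
def toFun {ν : ℝ} (F : Fock ν) : ℂ × ℂ → ℂ := F.1

instance instCoeFun (ν : ℝ) : CoeFun (Fock ν) (fun _ => ℂ × ℂ → ℂ) := ⟨toFun⟩

theorem differentiable {ν : ℝ} (F : Fock ν) : Differentiable ℂ (F : ℂ × ℂ → ℂ) := F.2.1

theorem memLp {ν : ℝ} (F : Fock ν) : MemLp (F : ℂ × ℂ → ℂ) 2 (gaussC2 ν) := F.2.2

/-- The linear map that sends a function of the Bargmann-Fock space to its class in `L²`. -/
def toL2 (ν : ℝ) : Fock ν →ₗ[ℂ] Lp ℂ 2 (gaussC2 ν) where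
  toFun F := F.memLp.toLp F
  map_add' _ _ := rfl
  map_smul' _ _ := rfl

theorem volume_absolutelyContinuous (ν : ℝ) : (volume : Measure (ℂ × ℂ)) ≪ gaussC2 ν := by
  refine withDensity_absolutelyContinuous' (by fun_prop) (Filter.Eventually.of_forall fun p => ?_)
  simp [Real.exp_pos]

theorem toL2_injective (ν : ℝ) : Function.Injective (toL2 ν) := by
  intro F G h
  have h1 : (F : ℂ × ℂ → ℂ) =ᵐ[gaussC2 ν] G := (MemLp.toLp_eq_toLp_iff F.memLp G.memLp).1 h
  exact Subtype.ext (Continuous.ae_eq_iff_eq volume F.differentiable.continuous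
    G.differentiable.continuous |>.1 ((volume_absolutelyContinuous ν).ae_eq h1))

/-- The `L²` norm. -/
instance instNormedAddCommGroup (ν : ℝ) : NormedAddCommGroup (Fock ν) :=
  NormedAddCommGroup.induced (Fock ν) (Lp ℂ 2 (gaussC2 ν)) (toL2 ν) (toL2_injective ν)

/-- The `L²` inner product. -/
instance instInnerProductSpace (ν : ℝ) : InnerProductSpace ℂ (Fock ν) where
  __ := NormedSpace.induced ℂ (Fock ν) (Lp ℂ 2 (gaussC2 ν)) (toL2 ν)
  inner F G := inner ℂ (toL2 ν F) (toL2 ν G)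
  norm_sq_eq_re_inner F := norm_sq_eq_re_inner (𝕜 := ℂ) (toL2 ν F)
  conj_inner_symm F G := inner_conj_symm (toL2 ν F) (toL2 ν G)
  add_left F G H := by rw [map_add, inner_add_left]
  smul_left F G c := by rw [map_smul, inner_smul_left]

theorem inner_eq_integral {ν : ℝ} (F G : Fock ν) :
    inner ℂ F G = ∫ p, G p * (starRingEnd ℂ) (F p) ∂(gaussC2 ν) := by
  change inner ℂ (toL2 ν F) (toL2 ν G) = _
  rw [L2.inner_def]
  refine integral_congr_ae ?_
  filter_upwards [F.memLp.coeFn_toLp, G.memLp.coeFn_toLp] with p h1 h2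
  change inner ℂ ((F.memLp.toLp F : Lp ℂ 2 (gaussC2 ν)) p)
    ((G.memLp.toLp G : Lp ℂ 2 (gaussC2 ν)) p) = _
  rw [h1, h2]
  rfl

end Fock

/-- The operator `D = ∂/∂z + i ∂/∂w`. -/
def opD (F : ℂ × ℂ → ℂ) (p : ℂ × ℂ) : ℂ :=
  deriv (fun z => F (z, p.2)) p.1 + Complex.I * deriv (fun w => F (p.1, w)) p.2

theorem opD_eq_fderiv {F : ℂ × ℂ → ℂ} (hF : Differentiable ℂ F) (p : ℂ × ℂ) :
    opD F p = fderiv ℂ F p (1, 0) + Complex.I * fderiv ℂ F p (0, 1) := by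
  have h1 : HasDerivAt (fun z => F (z, p.2)) (fderiv ℂ F p (1, 0)) p.1 :=
    (hF p).hasFDerivAt.comp_hasDerivAt p.1 (f := fun z => (z, p.2))
      ((hasDerivAt_id p.1).prodMk (hasDerivAt_const p.1 p.2))
  have h2 : HasDerivAt (fun w => F (p.1, w)) (fderiv ℂ F p (0, 1)) p.2 :=
    (hF p).hasFDerivAt.comp_hasDerivAt p.2 (f := fun w => (p.1, w))
      ((hasDerivAt_const p.2 p.1).prodMk (hasDerivAt_id p.2))
  rw [opD, h1.deriv, h2.deriv]

/-- The kernel of `D = ∂/∂z + i ∂/∂w` in the Bargmann-Fock space. -/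
def kerD (ν : ℝ) : Submodule ℂ (Fock ν) where
  carrier := {F | ∀ p : ℂ × ℂ, opD F p = 0}
  add_mem' := by
    intro F G hF hG p
    have h1 := hF p
    have h2 := hG p
    rw [opD_eq_fderiv (Fock.differentiable _)] at h1 h2 ⊢
    have h : fderiv ℂ ((F + G : Fock ν) : ℂ × ℂ → ℂ) p
        = fderiv ℂ (F : ℂ × ℂ → ℂ) p + fderiv ℂ (G : ℂ × ℂ → ℂ) p :=
      fderiv_add (F.differentiable p) (G.differentiable p)
    rw [h]
    simp only [add_apply]
    linear_combination h1 + h2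
  zero_mem' := by
    intro p
    have h : ((0 : Fock ν) : ℂ × ℂ → ℂ) = fun _ => 0 := rfl
    simp [opD, h]
  smul_mem' := by
    intro c F hF p
    have h1 := hF p
    rw [opD_eq_fderiv (Fock.differentiable _)] at h1 ⊢
    have h : fderiv ℂ ((c • F : Fock ν) : ℂ × ℂ → ℂ) p = c • fderiv ℂ (F : ℂ × ℂ → ℂ) p :=
      fderiv_const_smul (F.differentiable p) c
    rw [h]
    simp only [smul_apply, smul_eq_mul]
    linear_combination c * h1

/-- For `f` in `L^{2,ν}(ℝ, ℂ)` the integral in `segalBargmann` converges absolutely. -/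
theorem integrable_segalBargmann {ν : ℝ} (hν : 0 < ν) (f : L2R ν) (ζ : ℂ) :
    Integrable fun x : ℝ =>
      f x * Complex.exp (-(ν : ℂ) * ((x : ℂ) - ζ / (Real.sqrt 2 : ℂ)) ^ 2) := by
  set a : ℂ := ζ / (Real.sqrt 2 : ℂ)
  have hd : Measurable fun x : ℝ => ENNReal.ofReal (Real.exp (-ν * x ^ 2)) := by fun_prop
  have hlt : ∀ᵐ x : ℝ, ENNReal.ofReal (Real.exp (-ν * x ^ 2)) < ⊤ :=
    Filter.Eventually.of_forall fun x => ENNReal.ofReal_lt_top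
  let k : ℝ → ℂ := fun x => Complex.exp (2 * ν * a * x - ν * a ^ 2)
  have hkc : Continuous k := by fun_prop
  have hk : MemLp k 2 (gaussR ν) := by
    rw [memLp_two_iff_integrable_sq_norm hkc.aestronglyMeasurable, gaussR,
      integrable_withDensity_iff_integrable_smul' hd hlt]
    have h := (integrable_cexp_quadratic (b := (ν : ℂ)) (by simpa using hν)
      ((4 * ν * a.re : ℝ) : ℂ) ((-2 * (ν * a ^ 2).re : ℝ) : ℂ)).norm
    refine h.congr (Filter.Eventually.of_forall fun x => ?_)
    simp only [k, Complex.norm_exp, smul_eq_mul, ENNReal.toReal_ofReal (Real.exp_pos _).le,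
      ← Real.exp_nat_mul, ← Real.exp_add]
    congr 1
    simp [pow_two]
    ring
  have h := (integrable_withDensity_iff_integrable_smul' hd hlt).1
    ((Lp.memLp f).integrable_mul hk)
  refine h.congr (Filter.Eventually.of_forall fun x => ?_)
  simp only [k, Pi.mul_apply, ENNReal.toReal_ofReal (Real.exp_pos _).le, Complex.real_smul,
    Complex.ofReal_exp]
  rw [mul_left_comm, ← Complex.exp_add]
  congr 2
  push_cast
  ring

end BargmannFock

end

noncomputable section

namespace BargmannFock

/-! An entire `F` killed by `D` is constant along lines of direction `(1, i)`, so it is an entire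
function of `u = z + i w` (`apply_eq_apply_isotropic`). The space of such functions has reproducing
kernel `(ν/π)² exp(ν/2 · conj u(p) · u(q))` (`inner_kerDKernel`): a translation completes the square
and reduces the claim to a mean value property (`integral_gaussC2_of_differentiable`).

The kernel turns `L²` convergence into locally uniform convergence, which gives completeness
(`completeSpace_kerD`) and with it closedness. Rotation invariance makes the monomials orthogonal;
expanding the kernel in powers shows that a function orthogonal to all of them vanishes.

For (iii), `transformG ν f p` pairs `f` with an exponential in `L²(ℝ)`, and these exponentials have
the same Gram matrix as the reproducing kernels (`inner_transformKernel_transformKernel`). Hence a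
continuous map `J` carries the kernels to the exponentials. `J` yields preimages and its adjoint
realises the transform, so no inversion formula is needed. -/

/-! ### Families with equal Gram matrices -/

/-- Two families of vectors with the same Gram matrix, the first one total, are related by a
continuous linear map which also respects inner products with the vectors of the families. -/
theorem exists_continuousLinearMap_of_inner_eq {ι H L : Type*} [NormedAddCommGroup H]
    [InnerProductSpace ℂ H] [NormedAddCommGroup L] [InnerProductSpace ℂ L] [CompleteSpace L]
    (k : ι → H) (K : ι → L) (hk : Dense (Submodule.span ℂ (Set.range k) : Set H))
    (h : ∀ i j, inner ℂ (K i) (K j) = inner ℂ (k i) (k j)) :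
    ∃ J : H →L[ℂ] L, (∀ i, J (k i) = K i) ∧ ∀ i x, inner ℂ (K i) (J x) = inner ℂ (k i) x := by
  let a := Finsupp.linearCombination ℂ k
  let b := Finsupp.linearCombination ℂ K
  have hb : ∀ i x, inner ℂ (K i) (b x) = inner ℂ (k i) (a x) := by
    intro i x
    simp only [a, b, Finsupp.linearCombination_apply, Finsupp.inner_sum, inner_smul_right, h]
  have hbb : ∀ x y, inner ℂ (b x) (b y) = inner ℂ (a x) (a y) := by
    intro x y
    rw [show b x = x.sum fun i c => c • K i from rfl, show a x = x.sum fun i c => c • k i from rfl]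
    simp only [Finsupp.sum_inner, inner_smul_left, hb]
  -- This bound makes `b` factor through `a` and extend continuously from its dense range.
  have hn : ∀ x, ‖b x‖ ≤ 1 * ‖a x‖ := by
    intro x
    rw [one_mul, @norm_eq_sqrt_re_inner ℂ, @norm_eq_sqrt_re_inner ℂ _ _ _ _ (a x), hbb]
  have hd : DenseRange a := by
    have := hk
    rwa [← Finsupp.range_linearCombination] at this
  have hJ : ∀ x, b.extendOfNorm a (a x) = b x := LinearMap.extendOfNorm_eq hd ⟨1, hn⟩
  refine ⟨b.extendOfNorm a, fun i => ?_, fun i x => ?_⟩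
  · simpa [a, b] using hJ (Finsupp.single i 1)
  · refine hd.induction_on x (isClosed_eq (by fun_prop) (by fun_prop)) fun y => ?_
    rw [hJ, hb]

/-! ### Gaussian integrals on `ℂ²` -/

/-- The linear form `(z, w) ↦ z + i w`. -/
def isotropic (p : ℂ × ℂ) : ℂ := p.1 + Complex.I * p.2

@[fun_prop]
theorem differentiable_isotropic : Differentiable ℂ isotropic := by
  unfold isotropic; fun_prop

@[fun_prop]
theorem continuous_isotropic : Continuous isotropic := differentiable_isotropic.continuous

theorem isotropic_smul (c : ℂ) (p : ℂ × ℂ) : isotropic (c • p) = c * isotropic p := by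
  simp [isotropic]; ring

theorem norm_isotropic_sq_le (p : ℂ × ℂ) :
    ‖isotropic p‖ ^ 2 ≤ 2 * (‖p.1‖ ^ 2 + ‖p.2‖ ^ 2) := by
  have h : ‖isotropic p‖ ≤ ‖p.1‖ + ‖p.2‖ := by
    simpa [isotropic] using norm_add_le p.1 (Complex.I * p.2)
  nlinarith [norm_nonneg (isotropic p), sq_nonneg (‖p.1‖ - ‖p.2‖)]

/-- The Gaussian weight on `ℂ²` as a product of Gaussian weights. -/
theorem exp_weight_eq_mul (ν : ℝ) (p : ℂ × ℂ) :
    Real.exp (-ν * (‖p.1‖ ^ 2 + ‖p.2‖ ^ 2))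
      = Real.exp (-ν * ‖p.1‖ ^ 2) * Real.exp (-ν * ‖p.2‖ ^ 2) := by
  rw [← Real.exp_add]; ring_nf

theorem integrable_gaussian_complex {ν : ℝ} (hν : 0 < ν) :
    Integrable fun z : ℂ => Real.exp (-ν * ‖z‖ ^ 2) := by
  have h := GaussianFourier.integrable_cexp_neg_mul_sq_norm_add (V := ℂ) (b := (ν : ℂ))
    (by simpa using hν) 0 0
  refine h.norm.congr (Filter.Eventually.of_forall fun z => ?_)
  simp only [Complex.norm_exp]
  norm_cast
  simp

theorem integrable_weight {ν : ℝ} (hν : 0 < ν) :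
    Integrable fun p : ℂ × ℂ => Real.exp (-ν * (‖p.1‖ ^ 2 + ‖p.2‖ ^ 2)) := by
  simp only [exp_weight_eq_mul]
  exact (integrable_gaussian_complex hν).mul_prod (integrable_gaussian_complex hν)

theorem integral_weight {ν : ℝ} (hν : 0 < ν) :
    ∫ p : ℂ × ℂ, Real.exp (-ν * (‖p.1‖ ^ 2 + ‖p.2‖ ^ 2)) = (Real.pi / ν) ^ 2 := by
  simp only [exp_weight_eq_mul]
  have h := GaussianFourier.integral_rexp_neg_mul_sq_norm (V := ℂ) hν
  rw [Measure.volume_eq_prod, integral_prod_mul (fun z : ℂ => Real.exp (-ν * ‖z‖ ^ 2))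
    (fun z : ℂ => Real.exp (-ν * ‖z‖ ^ 2)), h, Complex.finrank_real_complex]
  norm_num
  ring

theorem integrable_gaussC2_iff {ν : ℝ} {F : ℂ × ℂ → ℂ} :
    Integrable F (gaussC2 ν) ↔
      Integrable fun p => (Real.exp (-ν * (‖p.1‖ ^ 2 + ‖p.2‖ ^ 2)) : ℂ) * F p := by
  rw [gaussC2, integrable_withDensity_iff_integrable_smul' (by fun_prop)
    (Filter.Eventually.of_forall fun _ => ENNReal.ofReal_lt_top)]
  simp only [ENNReal.toReal_ofReal (Real.exp_pos _).le, Complex.real_smul]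

theorem integral_gaussC2 {ν : ℝ} (F : ℂ × ℂ → ℂ) :
    ∫ p, F p ∂gaussC2 ν = ∫ p, (Real.exp (-ν * (‖p.1‖ ^ 2 + ‖p.2‖ ^ 2)) : ℂ) * F p := by
  rw [gaussC2, integral_withDensity_eq_integral_toReal_smul (by fun_prop)
    (Filter.Eventually.of_forall fun _ => ENNReal.ofReal_lt_top)]
  simp only [ENNReal.toReal_ofReal (Real.exp_pos _).le, Complex.real_smul]

/-- Continuous functions whose square grows slower than the weight decays lie in `L²`. -/
theorem memLp_gaussC2_of_norm_sq_le {ν : ℝ} (hν : 0 < ν) {F : ℂ × ℂ → ℂ} (hF : Continuous F)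
    (C : ℝ) (h : ∀ p, ‖F p‖ ^ 2 ≤ C * Real.exp (ν / 2 * (‖p.1‖ ^ 2 + ‖p.2‖ ^ 2))) :
    MemLp F 2 (gaussC2 ν) := by
  rw [memLp_two_iff_integrable_sq_norm hF.aestronglyMeasurable, gaussC2,
    integrable_withDensity_iff_integrable_smul' (by fun_prop)
    (Filter.Eventually.of_forall fun _ => ENNReal.ofReal_lt_top)]
  refine ((integrable_weight (half_pos hν)).const_mul C).mono'
    (Continuous.aestronglyMeasurable ?_) (Filter.Eventually.of_forall fun p => ?_)
  · simp only [ENNReal.toReal_ofReal (Real.exp_pos _).le]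
    fun_prop
  · rw [ENNReal.toReal_ofReal (Real.exp_pos _).le, Real.norm_of_nonneg (by positivity), smul_eq_mul]
    calc _ ≤ Real.exp (-ν * (‖p.1‖ ^ 2 + ‖p.2‖ ^ 2)) *
          (C * Real.exp (ν / 2 * (‖p.1‖ ^ 2 + ‖p.2‖ ^ 2))) := by gcongr; exact h p
      _ = C * (Real.exp (-ν * (‖p.1‖ ^ 2 + ‖p.2‖ ^ 2) + ν / 2 * (‖p.1‖ ^ 2 + ‖p.2‖ ^ 2))) := by
        rw [Real.exp_add]; ring
      _ = _ := by ring_nf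

theorem measurePreserving_smul_volume {a : ℂ} (ha : ‖a‖ = 1) :
    MeasurePreserving (fun p : ℂ × ℂ => a • p) := by
  have h : MeasurePreserving (fun z : ℂ => a * z) :=
    (rotation ⟨a, by simpa [Submonoid.unitSphere] using ha⟩).measurePreserving
  exact h.prod h

theorem integral_gaussC2_comp_smul {ν : ℝ} {a : ℂ} (ha : ‖a‖ = 1) (F : ℂ × ℂ → ℂ) :
    ∫ p, F (a • p) ∂gaussC2 ν = ∫ p, F p ∂gaussC2 ν := by
  have ha0 : a ≠ 0 := by rintro rfl; simp at ha
  have h := (measurePreserving_smul_volume ha).integral_comp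
    (Homeomorph.smulOfNeZero a ha0).measurableEmbedding
    fun p => (Real.exp (-ν * (‖p.1‖ ^ 2 + ‖p.2‖ ^ 2)) : ℂ) * F p
  rw [integral_gaussC2, integral_gaussC2, ← h]
  simp [ha]

theorem integrable_gaussC2_comp_smul {ν : ℝ} {a : ℂ} (ha : ‖a‖ = 1) {F : ℂ × ℂ → ℂ}
    (hF : Integrable F (gaussC2 ν)) : Integrable (fun p => F (a • p)) (gaussC2 ν) := by
  have ha0 : a ≠ 0 := by rintro rfl; simp at ha
  rw [integrable_gaussC2_iff] at hF ⊢
  have h := ((measurePreserving_smul_volume ha).integrable_comp_emb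
    (Homeomorph.smulOfNeZero a ha0).measurableEmbedding).2 hF
  simpa [Function.comp_def, norm_smul, ha] using h

/-- The mean value property for Gaussian integrals of entire functions on `ℂ²`. -/
theorem integral_gaussC2_of_differentiable {ν : ℝ} (hν : 0 < ν) {G : ℂ × ℂ → ℂ}
    (hG : Differentiable ℂ G) (hi : Integrable G (gaussC2 ν)) :
    ∫ p, G p ∂gaussC2 ν = ((Real.pi / ν) ^ 2 : ℝ) * G 0 := by
  have hc : ∀ θ, ‖circleMap 0 1 θ‖ = 1 := by simp
  -- The one-variable mean value property on the complex line through `0` and `p`; Fubini and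
  -- rotation invariance of the measure then give the result.
  have hm : ∀ p, ∫ θ in (0)..(2 * Real.pi), G (circleMap 0 1 θ • p) = (2 * Real.pi : ℝ) * G 0 := by
    intro p
    have hd : Differentiable ℂ fun t : ℂ => G (t • p) := by fun_prop
    have h := hd.diffContOnCl.circleAverage (c := 0) (R := 1)
    rw [Real.circleAverage_def, inv_smul_eq_iff₀ (by positivity)] at h
    simpa using h
  have hG' : Continuous fun x : ℝ × (ℂ × ℂ) => G (circleMap 0 1 x.1 • x.2) :=
    hG.continuous.comp (by fun_prop)
  have : SFinite (gaussC2 ν) := by unfold gaussC2; infer_instance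
  have hint : Integrable (fun x : ℝ × (ℂ × ℂ) => G (circleMap 0 1 x.1 • x.2))
      ((volume.restrict (Set.Ioc 0 (2 * Real.pi))).prod (gaussC2 ν)) := by
    rw [integrable_prod_iff hG'.aestronglyMeasurable]
    refine ⟨Filter.Eventually.of_forall fun θ => integrable_gaussC2_comp_smul (hc θ) hi, ?_⟩
    have h : ∀ θ, ∫ p, ‖G (circleMap 0 1 θ • p)‖ ∂gaussC2 ν = ∫ p, ‖G p‖ ∂gaussC2 ν := by
      intro θ
      have := integral_gaussC2_comp_smul (ν := ν) (hc θ) fun p => (‖G p‖ : ℂ)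
      simp only [integral_complex_ofReal] at this
      exact_mod_cast this
    simp only [h]
    exact integrable_const _
  have hs := integral_integral_swap
    (f := fun (θ : ℝ) p => G (circleMap 0 1 θ • p)) hint
  simp only [integral_gaussC2_comp_smul (hc _)] at hs
  simp only [intervalIntegral.integral_of_le Real.two_pi_pos.le] at hm
  have hconst : ∫ _, (2 * Real.pi : ℝ) * G 0 ∂gaussC2 ν
      = ((Real.pi / ν) ^ 2 : ℝ) * ((2 * Real.pi : ℝ) * G 0) := by
    rw [integral_gaussC2, integral_mul_const, integral_complex_ofReal, integral_weight hν]
  simp only [hm, hconst] at hs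
  have hp : ((2 * Real.pi : ℝ) : ℂ) ≠ 0 := by exact_mod_cast Real.two_pi_pos.ne'
  refine mul_left_cancel₀ hp ?_
  rw [mul_left_comm, ← hs]
  simp [Real.two_pi_pos.le]

/-! ### The kernel of `D` as entire functions of `z + i w` -/

/-- Functions in the kernel of `D` are functions of `z + i w`. -/
theorem apply_eq_apply_isotropic {F : ℂ × ℂ → ℂ} (hF : Differentiable ℂ F)
    (hD : ∀ p, opD F p = 0) (p : ℂ × ℂ) : F p = F (isotropic p, 0) := by
  have hline : ∀ t, HasDerivAt (fun t : ℂ => F (p + t • (1, Complex.I)))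
      (fderiv ℂ F (p + t • (1, Complex.I)) (1, Complex.I)) t := by
    intro t
    have h := ((hasDerivAt_id t).smul_const ((1, Complex.I) : ℂ × ℂ)).const_add p
    rw [one_smul] at h
    exact (hF (p + t • (1, Complex.I))).hasFDerivAt.comp_hasDerivAt t h
  have hzero : ∀ q, fderiv ℂ F q (1, Complex.I) = 0 := by
    intro q
    have h := hD q
    rw [opD_eq_fderiv hF, ← smul_eq_mul, ← map_smul, ← map_add] at h
    simpa using h
  -- The parameter `t = i w` is the one at which the second coordinate `w + t i` vanishes.
  have h := is_const_of_deriv_eq_zero (fun t => (hline t).differentiableAt)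
    (fun t => by rw [(hline t).deriv, hzero]) 0 (Complex.I * p.2)
  simp only [zero_smul, add_zero] at h
  rw [h]
  congr 1
  ext <;> simp [isotropic]
  rw [mul_right_comm, Complex.I_mul_I]
  ring

theorem opD_comp_isotropic {g : ℂ → ℂ} (hg : Differentiable ℂ g) (p : ℂ × ℂ) :
    opD (fun q => g (isotropic q)) p = 0 := by
  have h1 : HasDerivAt (fun z => g (isotropic (z, p.2))) (deriv g (isotropic p) * 1) p.1 :=
    (hg (isotropic p)).hasDerivAt.comp p.1 (h := fun z => isotropic (z, p.2))
      ((hasDerivAt_id p.1).add_const (Complex.I * p.2))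
  have h2 : HasDerivAt (fun w => g (isotropic (p.1, w)))
      (deriv g (isotropic p) * (Complex.I * 1)) p.2 :=
    (hg (isotropic p)).hasDerivAt.comp p.2 (h := fun w => isotropic (p.1, w))
      (((hasDerivAt_id p.2).const_mul Complex.I).const_add p.1)
  rw [opD, h1.deriv, h2.deriv]
  linear_combination deriv g (isotropic p) * Complex.I_mul_I

/-- The element of the kernel of `D` given by an entire function of `z + i w`. -/
def kerDOfEntire {ν : ℝ} (g : ℂ → ℂ) (hg : Differentiable ℂ g)
    (hm : MemLp (fun p => g (isotropic p)) 2 (gaussC2 ν)) : kerD ν :=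
  ⟨(⟨fun p => g (isotropic p), hg.comp differentiable_isotropic, hm⟩ : fockSubmodule ν),
    opD_comp_isotropic hg⟩

theorem kerD_apply_eq {ν : ℝ} (F : kerD ν) {p q : ℂ × ℂ} (h : isotropic p = isotropic q) :
    (F : Fock ν) p = (F : Fock ν) q := by
  rw [apply_eq_apply_isotropic F.1.differentiable F.2 p, h,
    ← apply_eq_apply_isotropic F.1.differentiable F.2 q]

theorem kerD_ext {ν : ℝ} {F G : kerD ν} (h : ∀ p, (F : Fock ν) p = (G : Fock ν) p) : F = G :=
  Subtype.ext (Subtype.ext (funext h))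

theorem inner_kerD {ν : ℝ} (F G : kerD ν) :
    inner ℂ F G = ∫ p, (G : Fock ν) p * (starRingEnd ℂ) ((F : Fock ν) p) ∂gaussC2 ν := by
  rw [Submodule.coe_inner, Fock.inner_eq_integral]

/-! ### Exponentials and monomials in `z + i w` -/

theorem memLp_exp_norm_isotropic {ν : ℝ} (hν : 0 < ν) (r : ℝ) :
    MemLp (fun p => (Real.exp (ν / 2 * r * ‖isotropic p‖) : ℂ)) 2 (gaussC2 ν) := by
  refine memLp_gaussC2_of_norm_sq_le hν (by fun_prop) (Real.exp (ν * r ^ 2)) fun p => ?_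
  rw [Complex.norm_real, Real.norm_of_nonneg (Real.exp_pos _).le, ← Real.exp_nat_mul,
    ← Real.exp_add, Real.exp_le_exp]
  have h : r * ‖isotropic p‖ ≤ r ^ 2 + (‖p.1‖ ^ 2 + ‖p.2‖ ^ 2) / 2 := by
    nlinarith [norm_isotropic_sq_le p, sq_nonneg (‖isotropic p‖ - 2 * r)]
  push_cast
  linear_combination ν * h

/-- The monomials `(z + i w)^m` as elements of the kernel of `D`. -/
def kerDMonomial {ν : ℝ} (hν : 0 < ν) (m : ℕ) : kerD ν :=
  kerDOfEntire (fun u => u ^ m) (differentiable_pow m) <| by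
    refine memLp_gaussC2_of_norm_sq_le hν (by fun_prop) ((4 / ν) ^ m * m.factorial) fun p => ?_
    -- The factor `ν / 4` is chosen because `‖z + i w‖² ≤ 2 (‖z‖² + ‖w‖²)` then gives exactly the
    -- admissible growth rate `ν / 2`.
    have h := Real.pow_div_factorial_le_exp (ν / 4 * ‖isotropic p‖ ^ 2) (by positivity) m
    rw [div_le_iff₀ (by positivity)] at h
    calc ‖isotropic p ^ m‖ ^ 2 = (4 / ν) ^ m * (ν / 4 * ‖isotropic p‖ ^ 2) ^ m := by
          rw [← mul_pow, norm_pow, pow_right_comm]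
          congr 1
          field_simp
      _ ≤ (4 / ν) ^ m * (Real.exp (ν / 4 * ‖isotropic p‖ ^ 2) * m.factorial) := by gcongr
      _ ≤ (4 / ν) ^ m * (Real.exp (ν / 2 * (‖p.1‖ ^ 2 + ‖p.2‖ ^ 2)) * m.factorial) := by
          refine mul_le_mul_of_nonneg_left (mul_le_mul_of_nonneg_right
            (Real.exp_le_exp.2 ?_) (by positivity)) (by positivity)
          nlinarith [norm_isotropic_sq_le p]
      _ = _ := by ring

theorem kerDMonomial_apply {ν : ℝ} (hν : 0 < ν) (m : ℕ) (p : ℂ × ℂ) :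
    (kerDMonomial hν m : Fock ν) p = isotropic p ^ m := rfl

theorem kerDMonomial_ne_zero {ν : ℝ} (hν : 0 < ν) (m : ℕ) : kerDMonomial hν m ≠ 0 := by
  intro h
  have h1 : (kerDMonomial hν m : Fock ν) (1, 0) = 0 := by rw [h]; rfl
  simp [kerDMonomial_apply, isotropic] at h1

/-- Rotating by the angle `π / (n - m)` preserves the measure and multiplies the integrand by `-1`.
-/
theorem inner_kerDMonomial {ν : ℝ} (hν : 0 < ν) {m n : ℕ} (hmn : m ≠ n) :
    inner ℂ (kerDMonomial hν m) (kerDMonomial hν n) = 0 := by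
  have hne : ((n : ℂ) - m) ≠ 0 := sub_ne_zero.2 (by exact_mod_cast hmn.symm)
  set t : ℝ := Real.pi / ((n : ℝ) - m) with ht
  set a : ℂ := Complex.exp (t * Complex.I)
  have ha : ‖a‖ = 1 := Complex.norm_exp_ofReal_mul_I t
  have h := integral_gaussC2_comp_smul (ν := ν) ha
    fun p => isotropic p ^ n * (starRingEnd ℂ) (isotropic p ^ m)
  have hph : a ^ n * (starRingEnd ℂ) a ^ m = -1 := by
    rw [← Complex.exp_conj, ← Complex.exp_nat_mul, ← Complex.exp_nat_mul, ← Complex.exp_add,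
      ← Complex.exp_pi_mul_I]
    congr 1
    simp only [ht, map_mul, Complex.conj_ofReal, Complex.conj_I]
    push_cast
    field_simp
    ring
  have h2 : ∀ p : ℂ × ℂ, isotropic (a • p) ^ n * (starRingEnd ℂ) (isotropic (a • p) ^ m)
      = -1 * (isotropic p ^ n * (starRingEnd ℂ) (isotropic p ^ m)) := by
    intro p
    rw [← hph, isotropic_smul]
    simp only [map_mul, map_pow, mul_pow]
    ring
  simp only [h2, integral_const_mul] at h
  rw [inner_kerD]
  simp only [kerDMonomial_apply]
  linear_combination -h / 2

/-! ### The reproducing kernel -/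

/-- The reproducing kernel of the kernel of `D`. -/
def kerDKernel {ν : ℝ} (hν : 0 < ν) (p : ℂ × ℂ) : kerD ν :=
  kerDOfEntire
    (fun u => ((ν / Real.pi) ^ 2 : ℝ) * Complex.exp (ν / 2 * (starRingEnd ℂ) (isotropic p) * u))
    (by fun_prop) <| by
    refine (memLp_exp_norm_isotropic hν ‖isotropic p‖).const_mul (((ν / Real.pi) ^ 2 : ℝ) : ℂ)
      |>.mono (Continuous.aestronglyMeasurable (by fun_prop))
        (Filter.Eventually.of_forall fun q => ?_)
    rw [norm_mul, norm_mul]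
    gcongr
    rw [Complex.norm_exp, Complex.norm_real, Real.norm_of_nonneg (Real.exp_pos _).le]
    gcongr
    refine (Complex.re_le_norm _).trans_eq ?_
    simp [abs_of_pos hν]

theorem kerDKernel_apply {ν : ℝ} (hν : 0 < ν) (p q : ℂ × ℂ) :
    (kerDKernel hν p : Fock ν) q = ((ν / Real.pi) ^ 2 : ℝ) *
      Complex.exp (ν / 2 * (starRingEnd ℂ) (isotropic p) * isotropic q) := rfl

theorem conj_kerDKernel {ν : ℝ} (hν : 0 < ν) (p q : ℂ × ℂ) :
    (starRingEnd ℂ) ((kerDKernel hν p : Fock ν) q) = ((ν / Real.pi) ^ 2 : ℝ) *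
      Complex.exp (ν / 2 * isotropic p * (starRingEnd ℂ) (isotropic q)) := by
  rw [kerDKernel_apply, map_mul, Complex.conj_ofReal, ← Complex.exp_conj]
  simp only [map_mul, map_div₀, Complex.conj_ofReal, Complex.conj_conj, Complex.conj_ofNat]

theorem integrable_kerD_mul_conj {ν : ℝ} (F G : kerD ν) :
    Integrable (fun p => (G : Fock ν) p * (starRingEnd ℂ) ((F : Fock ν) p)) (gaussC2 ν) :=
  G.1.memLp.integrable_mul F.1.memLp.star

/-- The reproducing property. -/
theorem inner_kerDKernel {ν : ℝ} (hν : 0 < ν) (p : ℂ × ℂ) (F : kerD ν) :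
    inner ℂ (kerDKernel hν p) F = (F : Fock ν) p := by
  set u := isotropic p with hu
  -- A point with the same `z + i w` as `p`, so `F` agrees there. Being a multiple of `(1, -i)`, it
  -- makes translation by it cancel the antiholomorphic exponential in the conjugated kernel,
  -- leaving the entire integrand `G`.
  let p' : ℂ × ℂ := (u / 2, -Complex.I * (u / 2))
  let c : ℂ := ((ν / Real.pi) ^ 2 : ℝ)
  let G : ℂ × ℂ → ℂ := fun q =>
    c * ((F : Fock ν) (q + p') * Complex.exp (-(ν / 2 * (starRingEnd ℂ) u * isotropic q)))
  have hp' : isotropic p' = u := by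
    simp only [isotropic, p']
    linear_combination -(u / 2) * Complex.I_mul_I
  have hF := F.1.differentiable
  have hG : Differentiable ℂ G := by
    have : Differentiable ℂ fun q : ℂ × ℂ => (F : Fock ν) (q + p') :=
      hF.comp (differentiable_id.add_const p')
    fun_prop
  have hshift : ∀ q : ℂ × ℂ,
      (Real.exp (-ν * (‖(q + p').1‖ ^ 2 + ‖(q + p').2‖ ^ 2)) : ℂ) * ((F : Fock ν) (q + p') *
        (starRingEnd ℂ) ((kerDKernel hν p : Fock ν) (q + p')))
      = (Real.exp (-ν * (‖q.1‖ ^ 2 + ‖q.2‖ ^ 2)) : ℂ) * G q := by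
    intro q
    have hexp : (Real.exp (-ν * (‖(q + p').1‖ ^ 2 + ‖(q + p').2‖ ^ 2)) : ℂ) *
        Complex.exp (ν / 2 * u * (starRingEnd ℂ) (isotropic (q + p')))
        = (Real.exp (-ν * (‖q.1‖ ^ 2 + ‖q.2‖ ^ 2)) : ℂ) *
          Complex.exp (-(ν / 2 * (starRingEnd ℂ) u * isotropic q)) := by
      push_cast
      rw [← Complex.exp_add, ← Complex.exp_add]
      congr 1
      simp only [← Complex.mul_conj', isotropic, p', Prod.fst_add, Prod.snd_add, map_add, map_mul,
        map_div₀, map_neg, Complex.conj_I, Complex.conj_ofNat]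
      ring_nf
    rw [conj_kerDKernel]
    simp only [G, c]
    linear_combination ((F : Fock ν) (q + p') * ((ν / Real.pi) ^ 2 : ℝ)) * hexp
  have : (volume : Measure (ℂ × ℂ)).IsAddRightInvariant := by
    rw [Measure.volume_eq_prod]
    infer_instance
  have hint : Integrable G (gaussC2 ν) := by
    have h := integrable_gaussC2_iff.1 (integrable_kerD_mul_conj (kerDKernel hν p) F)
    rw [integrable_gaussC2_iff]
    exact (h.comp_add_right p').congr (Filter.Eventually.of_forall hshift)
  have hG0 : G 0 = c * (F : Fock ν) p := by
    have h1 : (F : Fock ν) p' = (F : Fock ν) p := kerD_apply_eq F hp'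
    simp [G, isotropic, h1]
  rw [inner_kerD, integral_gaussC2, ← integral_add_right_eq_self _ p']
  simp only [hshift]
  rw [← integral_gaussC2, integral_gaussC2_of_differentiable hν hG hint, hG0, ← mul_assoc]
  have : (((Real.pi / ν) ^ 2 : ℝ) : ℂ) * c = 1 := by
    simp only [c]
    have := Real.pi_pos.ne'
    rw [← Complex.ofReal_mul, ← mul_pow, div_mul_div_cancel₀ hν.ne', div_self this]
    simp
  rw [this, one_mul]

/-! ### Completeness and density -/

/-- The isometric embedding of the kernel of `D` into `L²`. -/
def kerDToL2 (ν : ℝ) : kerD ν →ₗᵢ[ℂ] Lp ℂ 2 (gaussC2 ν) :=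
  ⟨(Fock.toL2 ν).comp (kerD ν).subtype, fun _ => rfl⟩

theorem continuous_norm_kerDKernel {ν : ℝ} (hν : 0 < ν) :
    Continuous fun p => ‖kerDKernel hν p‖ := by
  simp only [@norm_eq_sqrt_re_inner ℂ, inner_kerDKernel, kerDKernel_apply]
  fun_prop

theorem completeSpace_kerD {ν : ℝ} (hν : 0 < ν) : CompleteSpace (kerD ν) := by
  refine Metric.complete_of_cauchySeq_tendsto fun F hF => ?_
  obtain ⟨φ, hφ⟩ := cauchySeq_tendsto_of_complete
    ((kerDToL2 ν).isometry.uniformContinuous.comp_cauchySeq hF)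
  -- The reproducing formula applied to the `L²` limit `φ` gives a pointwise candidate for the limit
  -- function.
  let g : ℂ → ℂ := fun u => inner ℂ (kerDToL2 ν (kerDKernel hν (u, 0))) φ
  have hbound : ∀ n u, ‖g u - (F n : Fock ν) (u, 0)‖
      ≤ ‖kerDKernel hν (u, 0)‖ * ‖φ - kerDToL2 ν (F n)‖ := by
    intro n u
    rw [← inner_kerDKernel hν (u, 0) (F n), ← (kerDToL2 ν).inner_map_map, ← inner_sub_right,
      ← (kerDToL2 ν).norm_map]
    exact norm_inner_le_norm _ _
  have hlim : Filter.Tendsto (fun n => ‖φ - kerDToL2 ν (F n)‖) Filter.atTop (nhds 0) := by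
    simpa using (tendsto_const_nhds (x := φ).sub hφ).norm
  have hunif : TendstoLocallyUniformlyOn (fun n u => (F n : Fock ν) (u, 0)) g Filter.atTop
      Set.univ := by
    rw [Metric.tendstoLocallyUniformlyOn_iff]
    intro ε hε u _
    set M : ℂ → ℝ := fun v => ‖kerDKernel hν (v, 0)‖
    have hM : Continuous M := (continuous_norm_kerDKernel hν).comp (by fun_prop)
    refine ⟨{v | M v < M u + 1}, mem_nhdsWithin_of_mem_nhds
      ((isOpen_lt hM continuous_const).mem_nhds (by simp)), ?_⟩
    have hM0 : 0 < M u + 1 := by positivity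
    filter_upwards [hlim.eventually_lt_const (div_pos hε hM0)] with n hn v hv
    rw [dist_eq_norm]
    calc _ ≤ M v * ‖φ - kerDToL2 ν (F n)‖ := hbound n v
      _ ≤ (M u + 1) * ‖φ - kerDToL2 ν (F n)‖ := by gcongr
      _ < ε := by rwa [lt_div_iff₀' hM0] at hn
  have hg : Differentiable ℂ g := by
    rw [← differentiableOn_univ]
    refine hunif.differentiableOn (Filter.Eventually.of_forall fun n => ?_) isOpen_univ
    have hFn := (F n).1.differentiable
    exact (hFn.comp (f := fun u : ℂ => (u, (0 : ℂ))) (by fun_prop)).differentiableOn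
  -- An almost everywhere convergent subsequence identifies `φ` with the pointwise limit `g (z + i
  -- w)`.
  obtain ⟨ns, hns, hae⟩ := (tendstoInMeasure_of_tendsto_Lp hφ).exists_seq_tendsto_ae
  have hφg : ∀ᵐ p ∂gaussC2 ν, φ p = g (isotropic p) := by
    have hcoe : ∀ᵐ p ∂gaussC2 ν, ∀ n, kerDToL2 ν (F n) p = (F n : Fock ν) p :=
      ae_all_iff.2 fun n => (F n).1.memLp.coeFn_toLp
    filter_upwards [hae, hcoe] with p hp hp'
    refine tendsto_nhds_unique hp ?_
    have h := (hunif.tendsto_at (Set.mem_univ (isotropic p))).comp hns.tendsto_atTop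
    refine h.congr fun n => ?_
    simp only [Function.comp_apply]
    rw [hp', apply_eq_apply_isotropic (F (ns n)).1.differentiable (F (ns n)).2 p]
  have hm : MemLp (fun p => g (isotropic p)) 2 (gaussC2 ν) := (Lp.memLp φ).ae_eq hφg
  refine ⟨kerDOfEntire g hg hm, ?_⟩
  rw [(kerDToL2 ν).isometry.isEmbedding.tendsto_nhds_iff]
  have : kerDToL2 ν (kerDOfEntire g hg hm) = φ := by
    refine Lp.ext ?_
    filter_upwards [hm.coeFn_toLp, hφg] with p hp hp'
    exact hp.trans hp'.symm
  rw [this]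
  exact hφ

theorem dense_span_kerDKernel {ν : ℝ} (hν : 0 < ν) :
    Dense (Submodule.span ℂ (Set.range (kerDKernel hν)) : Set (kerD ν)) := by
  have := completeSpace_kerD hν
  rw [Submodule.dense_iff_topologicalClosure_eq_top, Submodule.topologicalClosure_eq_top_iff,
    Submodule.eq_bot_iff]
  intro F hF
  refine kerD_ext fun p => ?_
  rw [← inner_kerDKernel hν p F]
  exact (Submodule.mem_orthogonal _ _).1 hF _ (Submodule.subset_span ⟨p, rfl⟩)

/-- The reproducing kernel expands in monomials. -/
theorem hasSum_inner_kerDMonomial {ν : ℝ} (hν : 0 < ν) (p : ℂ × ℂ) (F : kerD ν) :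
    HasSum (fun n => (((ν / Real.pi) ^ 2 : ℝ) : ℂ) * ((ν / 2 * isotropic p) ^ n / n.factorial) *
      inner ℂ (kerDMonomial hν n) F) ((F : Fock ν) p) := by
  have hF := F.1.differentiable.continuous
  set c : ℂ := (((ν / Real.pi) ^ 2 : ℝ) : ℂ)
  have key := hasSum_integral_of_dominated_convergence (μ := gaussC2 ν)
    (F := fun n q => c * ((ν / 2 * isotropic p) ^ n / n.factorial) *
      ((F : Fock ν) q * (starRingEnd ℂ) (isotropic q ^ n)))
    (f := fun q => (F : Fock ν) q * (starRingEnd ℂ) ((kerDKernel hν p : Fock ν) q))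
    (fun n q => ‖c‖ * ‖(F : Fock ν) q‖ *
      ((ν / 2 * ‖isotropic p‖ * ‖isotropic q‖) ^ n / n.factorial))
    (fun n => Continuous.aestronglyMeasurable
      (by have := Complex.continuous_conj; fun_prop))
    (fun n => Filter.Eventually.of_forall fun q => ?_)
    (Filter.Eventually.of_forall fun q => ?_) ?_ (Filter.Eventually.of_forall fun q => ?_)
  · rw [← inner_kerD, inner_kerDKernel] at key
    simpa only [integral_const_mul, inner_kerD, kerDMonomial_apply] using key
  · refine le_of_eq ?_
    simp only [norm_mul, norm_div, norm_pow, Complex.norm_natCast, RCLike.norm_conj,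
      Complex.norm_real, Real.norm_of_nonneg hν.le, Complex.norm_ofNat, mul_pow]
    ring
  · exact Summable.mul_left _ (Real.summable_pow_div_factorial _)
  -- The dominating series sums to `‖F‖` times an exponential of `‖z + i w‖`, a product of two `L²`
  -- functions.
  · have h := (F.1.memLp.integrable_mul (memLp_exp_norm_isotropic hν ‖isotropic p‖)).norm.const_mul
      ‖c‖
    refine h.congr (Filter.Eventually.of_forall fun q => ?_)
    simp only [tsum_mul_left, Pi.mul_apply, norm_mul, Complex.norm_real,
      Real.norm_of_nonneg (Real.exp_pos _).le]
    rw [← mul_assoc, Real.exp_eq_exp_ℝ, NormedSpace.exp_eq_tsum_div]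
  · have h := (NormedSpace.expSeries_div_hasSum_exp (𝔸 := ℂ)
      (ν / 2 * isotropic p * (starRingEnd ℂ) (isotropic q))).mul_left (c * (F : Fock ν) q)
    rw [← Complex.exp_eq_exp_ℂ] at h
    have h2 : (F : Fock ν) q * (starRingEnd ℂ) ((kerDKernel hν p : Fock ν) q) = c * (F : Fock ν) q *
        Complex.exp (ν / 2 * isotropic p * (starRingEnd ℂ) (isotropic q)) := by
      rw [conj_kerDKernel]; ring
    rw [h2]
    refine h.congr_fun ?_
    intro n
    rw [map_pow, mul_pow _ ((starRingEnd ℂ) _)]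
    ring

theorem topologicalClosure_span_kerDMonomial {ν : ℝ} (hν : 0 < ν) :
    (Submodule.span ℂ (Set.range (kerDMonomial hν))).topologicalClosure = ⊤ := by
  have := completeSpace_kerD hν
  rw [Submodule.topologicalClosure_eq_top_iff, Submodule.eq_bot_iff]
  intro F hF
  refine kerD_ext fun p => ?_
  have h : ∀ n, inner ℂ (kerDMonomial hν n) F = 0 := fun n =>
    (Submodule.mem_orthogonal _ _).1 hF _ (Submodule.subset_span ⟨n, rfl⟩)
  have hs := hasSum_inner_kerDMonomial hν p F
  simp only [h, mul_zero] at hs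
  exact hs.unique hasSum_zero

/-! ### The transform and its range -/

theorem integral_gaussR {ν : ℝ} (f : ℝ → ℂ) :
    ∫ x, f x ∂gaussR ν = ∫ x, (Real.exp (-ν * x ^ 2) : ℂ) * f x := by
  rw [gaussR, integral_withDensity_eq_integral_toReal_smul (by fun_prop)
    (Filter.Eventually.of_forall fun _ => ENNReal.ofReal_lt_top)]
  simp only [ENNReal.toReal_ofReal (Real.exp_pos _).le, Complex.real_smul]

theorem memLp_exp_gaussR {ν : ℝ} (hν : 0 < ν) (a b : ℂ) :
    MemLp (fun x : ℝ => Complex.exp (a * x + b)) 2 (gaussR ν) := by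
  have hc : Continuous fun x : ℝ => Complex.exp (a * x + b) := by fun_prop
  rw [memLp_two_iff_integrable_sq_norm hc.aestronglyMeasurable, gaussR,
    integrable_withDensity_iff_integrable_smul' (by fun_prop)
      (Filter.Eventually.of_forall fun _ => ENNReal.ofReal_lt_top)]
  have h := (integrable_cexp_quadratic (b := (ν : ℂ)) (by simpa using hν)
    ((2 * a.re : ℝ) : ℂ) ((2 * b.re : ℝ) : ℂ)).norm
  refine h.congr (Filter.Eventually.of_forall fun x => ?_)
  simp only [Complex.norm_exp, smul_eq_mul, ENNReal.toReal_ofReal (Real.exp_pos _).le,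
    ← Real.exp_nat_mul, ← Real.exp_add]
  congr 1
  simp [pow_two]
  ring

/-- The constant in front of the integral defining `transformG`. -/
def transformConst (ν : ℝ) : ℝ := (ν / Real.pi) ^ (1 / 2 : ℝ) * (ν / Real.pi) ^ (3 / 4 : ℝ)

/-- The function against which `f` is integrated in `transformG ν f p`. -/
def transformKernelFun (ν : ℝ) (p : ℂ × ℂ) (x : ℝ) : ℂ :=
  transformConst ν * Complex.exp (ν * (starRingEnd ℂ) (isotropic p) * x +
    -(ν / 4 * (starRingEnd ℂ) (isotropic p) ^ 2))

theorem memLp_transformKernelFun {ν : ℝ} (hν : 0 < ν) (p : ℂ × ℂ) :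
    MemLp (transformKernelFun ν p) 2 (gaussR ν) :=
  (memLp_exp_gaussR hν _ _).const_mul _

/-- `transformKernelFun` as an element of `L²`. -/
def transformKernel {ν : ℝ} (hν : 0 < ν) (p : ℂ × ℂ) : L2R ν :=
  (memLp_transformKernelFun hν p).toLp

theorem transformG_eq_integral (ν : ℝ) (f : ℝ → ℂ) (p : ℂ × ℂ) :
    transformG ν f p
      = ∫ x, f x * (starRingEnd ℂ) (transformKernelFun ν p x) ∂gaussR ν := by
  rw [integral_gaussR, transformG, segalBargmann, ← mul_assoc, ← Complex.ofReal_mul,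
    ← transformConst, ← integral_const_mul]
  refine integral_congr_ae (Filter.Eventually.of_forall fun x => ?_)
  have h2 : (Real.sqrt 2 : ℂ) * Real.sqrt 2 = 2 := by
    rw [← Complex.ofReal_mul, Real.mul_self_sqrt (by norm_num)]; simp
  simp only [transformKernelFun, map_mul, Complex.conj_ofReal, ← Complex.exp_conj, map_add, map_neg,
    map_div₀, map_pow, Complex.conj_conj, Complex.conj_ofNat]
  rw [div_div, h2, ← isotropic]
  have : Complex.exp (-(ν : ℂ) * ((x : ℂ) - isotropic p / 2) ^ 2) = (Real.exp (-ν * x ^ 2) : ℂ) *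
      Complex.exp (ν * isotropic p * x + -(ν / 4 * isotropic p ^ 2)) := by
    push_cast
    rw [← Complex.exp_add]
    congr 1
    ring
  rw [this]
  ring

theorem inner_transformKernel {ν : ℝ} (hν : 0 < ν) (p : ℂ × ℂ) (f : L2R ν) :
    inner ℂ (transformKernel hν p) f = transformG ν f p := by
  rw [L2.inner_def, transformG_eq_integral]
  refine integral_congr_ae ?_
  filter_upwards [(memLp_transformKernelFun hν p).coeFn_toLp] with x hx
  rw [transformKernel, hx]
  rfl

/-- The exponents of `ν/π` add up to `2 (1/2 + 3/4) - 1/2 = 2`, matching the normalisations on `ℝ`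
and on `ℂ²`. -/
theorem transformConst_sq_mul {ν : ℝ} (hν : 0 < ν) :
    transformConst ν ^ 2 * (Real.pi / ν) ^ (1 / 2 : ℝ) = (ν / Real.pi) ^ 2 := by
  have h : 0 < ν / Real.pi := div_pos hν Real.pi_pos
  rw [transformConst, ← Real.rpow_add h, ← Real.rpow_mul_natCast h.le, ← inv_div ν,
    Real.inv_rpow h.le, ← Real.rpow_neg h.le, ← Real.rpow_add h, ← Real.rpow_natCast]
  norm_num

/-- The Gaussian integral over `ℝ` produces the exponent `ν (u + v)² / 4 - ν (u² + v²) / 4 = ν u v /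
2`, which is that of the reproducing kernel. -/
theorem inner_transformKernel_transformKernel {ν : ℝ} (hν : 0 < ν) (p q : ℂ × ℂ) :
    inner ℂ (transformKernel hν p) (transformKernel hν q)
      = inner ℂ (kerDKernel hν p) (kerDKernel hν q) := by
  set u := isotropic p with hu
  set v := (starRingEnd ℂ) (isotropic q) with hv
  rw [inner_kerDKernel, kerDKernel_apply, inner_transformKernel, transformG_eq_integral]
  have h1 : ∫ x, transformKernel hν q x * (starRingEnd ℂ) (transformKernelFun ν p x) ∂gaussR ν
      = ∫ x, transformKernelFun ν q x * (starRingEnd ℂ) (transformKernelFun ν p x) ∂gaussR ν := by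
    refine integral_congr_ae ?_
    filter_upwards [(memLp_transformKernelFun hν q).coeFn_toLp] with x hx
    rw [transformKernel, hx]
  have h2 : ∀ x : ℝ, (Real.exp (-ν * x ^ 2) : ℂ) *
      (transformKernelFun ν q x * (starRingEnd ℂ) (transformKernelFun ν p x))
      = (transformConst ν : ℂ) ^ 2 *
        Complex.exp (-ν * x ^ 2 + ν * (u + v) * x + -(ν / 4 * (u ^ 2 + v ^ 2))) := by
    intro x
    simp only [transformKernelFun, map_mul, Complex.conj_ofReal, ← Complex.exp_conj, map_add,
      map_neg, map_div₀, map_pow, Complex.conj_conj, Complex.conj_ofNat, ← hu, ← hv]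
    have : Complex.exp (-ν * x ^ 2 + ν * (u + v) * x + -(ν / 4 * (u ^ 2 + v ^ 2)))
        = (Real.exp (-ν * x ^ 2) : ℂ) * Complex.exp (ν * v * x + -(ν / 4 * v ^ 2)) *
          Complex.exp (ν * u * x + -(ν / 4 * u ^ 2)) := by
      push_cast
      rw [← Complex.exp_add, ← Complex.exp_add]
      congr 1
      ring
    rw [this]
    ring
  have hν' : (ν : ℂ) ≠ 0 := by exact_mod_cast hν.ne'
  rw [h1, integral_gaussR]
  simp only [h2]
  rw [integral_const_mul, integral_cexp_quadratic (by simpa using hν), neg_neg, ← mul_assoc,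
    ← transformConst_sq_mul hν, Complex.ofReal_mul, Complex.ofReal_pow,
    Complex.ofReal_cpow (div_pos Real.pi_pos hν).le]
  congr 2
  · norm_num
  · field_simp
    ring

/-- The kernel of `D` is the range of the transform. -/
theorem image_kerD_eq_range_transformG {ν : ℝ} (hν : 0 < ν) :
    (fun F : Fock ν => (F : ℂ × ℂ → ℂ)) '' (kerD ν)
      = Set.range (fun f : L2R ν => transformG ν f) := by
  have := completeSpace_kerD hν
  obtain ⟨J, hJ, hJ'⟩ := exists_continuousLinearMap_of_inner_eq (kerDKernel hν)
    (transformKernel hν) (dense_span_kerDKernel hν) (inner_transformKernel_transformKernel hν)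
  ext G
  constructor
  · rintro ⟨F, hF, rfl⟩
    refine ⟨J ⟨F, hF⟩, funext fun p => ?_⟩
    change transformG ν (J ⟨F, hF⟩) p = F p
    rw [← inner_transformKernel hν, hJ', inner_kerDKernel]
  · rintro ⟨f, rfl⟩
    -- The value of `J.adjoint f` at `p` is its pairing with the reproducing kernel, which `J` moves
    -- to the exponential paired with `f`.
    refine ⟨(J.adjoint f).1, (J.adjoint f).2, funext fun p => ?_⟩
    change ((J.adjoint f : kerD ν) : Fock ν) p = transformG ν f p
    rw [← inner_kerDKernel hν, ContinuousLinearMap.adjoint_inner_right, hJ, inner_transformKernel]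

end BargmannFock

end

theorem mainTheorem2 (ν : ℝ) (hν : 0 < ν) :
    -- (i) the kernel is closed in the Bargmann-Fock space
    IsClosed (BargmannFock.kerD ν : Set (BargmannFock.Fock ν)) ∧
    -- (ii) it is a Hilbert space and the functions `(z + i w)^m` are an orthogonal basis of it
    (CompleteSpace (BargmannFock.kerD ν) ∧
      ∃ e : ℕ → BargmannFock.kerD ν,
        (∀ (m : ℕ) (z w : ℂ), (e m : BargmannFock.Fock ν) (z, w) = (z + Complex.I * w) ^ m) ∧
        (∀ m : ℕ, e m ≠ 0) ∧
        (∀ m n : ℕ, m ≠ n → inner ℂ (e m) (e n) = 0) ∧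
        (Submodule.span ℂ (Set.range e)).topologicalClosure = ⊤) ∧
    -- (iii) as a set of functions it is the image of `L^{2,ν}(ℝ, ℂ)` under the transform
    (fun F : BargmannFock.Fock ν => (F : ℂ × ℂ → ℂ)) '' (BargmannFock.kerD ν) =
      Set.range (fun f : BargmannFock.L2R ν => BargmannFock.transformG ν f) := by
  have := BargmannFock.completeSpace_kerD hν
  exact ⟨(completeSpace_coe_iff_isComplete.1 this).isClosed, ⟨this,
    BargmannFock.kerDMonomial hν, fun m z w => BargmannFock.kerDMonomial_apply hν m (z, w),
    BargmannFock.kerDMonomial_ne_zero hν, fun m n h => BargmannFock.inner_kerDMonomial hν h,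
    BargmannFock.topologicalClosure_span_kerDMonomial hν⟩,
    BargmannFock.image_kerD_eq_range_transformG hν⟩
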